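/- Let $R$ be a commutative ring and let $(X,\check X,\Phi,\check\Phi,\Pi,\check\Pi)$ be a reduced based root datum: $X,\check X$ are free abelian groups of finite rank with a perfect pairing $\langle\cdot,\cdot\rangle:X\times\check X\to\mathbb Z$, $\Phi\subset X$ and $\check\Phi\subset\check X$ are the finite sets of roots and coroots, and $\Pi,\check\Pi$ are the simple roots and coroots. Let $\Phi^+$ be the set of positive roots, let $W_0\subset GL(\check X)$ be the finite Weyl group, generated by the reflections $x\mapsto x-\langle\alpha,x\rangle\check\alpha$ $(\alpha\in\Phi)$, let $\check X^+=\{x\in\check X:\langle\alpha,x\rangle\ge 0\text{ for all }\alpha\in\Phi^+\}$ be the monoid of dominant coweights, and let $\ell(x)=\sum_{\alpha\in\Phi^+}|\langle\alpha,x\rangle|$ be the length function on $\check X$. Put $$\mathcal C(\check X)=\{(x,k)\in\check X\oplus\mathbb Z: k\ge\ell(x)\},$$ a monoid on which $W_0$ acts by $w(x,k)=(wx,k)$. Regard its semigroup algebra $R[\mathcal C(\check X)]$ as an $R[q]$-algebra via $q\mapsto e^{(0,1)}$. Then the following hold. 1. There is an isomorphism of $R$-algebras $$R[\mathcal C(\check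 X)]\cong \mathrm{Rees}\,R[\check X]=\bigoplus_{i\ge 0}t^iF^iR[\check X],\qquad e^{(x,k)}\mapsto t^ke^x,$$ where $F^iR[\check X]$ is the $R$-span of the $e^x$ with $\ell(x)\le i$. 2. There is an isomorphism of $R[q]$-algebras $$\varphi: R[\mathcal C(\check X)]^{W_0}\;\cong\;R[q][\check X^+].$$ 3. The isomorphism $\varphi$ in 2 can be chosen so that setting $q=1$ in it gives an isomorphism of $R$-algebras $\psi:R[\check X]^{W_0}\cong R[\check X^+]$. That is, $\psi$ is compatible with $\varphi$ under the maps $R[\mathcal C(\check X)]^{W_0}\to R[\check X]^{W_0}$, $e^{(x,k)}\mapsto e^x$, and $R[q][\check X^+]\to R[\check X^+]$, $q\mapsto 1$. -/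

import Mathlib

noncomputable section

namespace BasedRootDatum

variable {ι X Y : Type*} [AddCommGroup X] [AddCommGroup Y] {P : RootDatum ι X Y}

/-- The finite Weyl group `W₀`: the subgroup of `GL(Y)` generated by the reflections
`y ↦ y - ⟨α, y⟩ α^∨`, where `Y` is the coweight lattice. -/
def weyl (P : RootDatum ι X Y) : Subgroup (Y ≃ₗ[ℤ] Y) :=
  Subgroup.closure (Set.range P.coreflection)

section Length

variable [Fintype ι]

open Classical in
/-- The length function `ℓ(y) = ∑_{α > 0} |⟨α, y⟩|` on the coweight lattice. -/
def len (b : P.Base) (y : Y) : ℤ :=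
  ∑ i : ι with b.IsPos i, |P.toLinearMap (P.root i) y|

theorem len_nonneg (b : P.Base) (y : Y) : 0 ≤ len b y :=
  Finset.sum_nonneg fun _ _ => abs_nonneg _

theorem len_zero (b : P.Base) : len b (0 : Y) = 0 := by
  simp [len]

theorem len_add_le (b : P.Base) (y z : Y) : len b (y + z) ≤ len b y + len b z := by
  unfold len
  rw [← Finset.sum_add_distrib]
  refine Finset.sum_le_sum fun i _ => ?_
  rw [map_add]
  exact abs_add_le _ _

theorem two_mul_len (b : P.Base) (y : Y) :
    2 * len b y = ∑ i : ι, |P.toLinearMap (P.root i) y| := by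
  classical
  let := P.indexNeg
  have key : ∑ i : ι with ¬ b.IsPos i, |P.toLinearMap (P.root i) y| = len b y := by
    unfold len
    refine Finset.sum_bij' (fun i _ => -i) (fun i _ => -i) ?_ ?_ ?_ ?_ ?_
    · intro i hi
      simp only [Finset.mem_filter, Finset.mem_univ, true_and] at hi ⊢
      exact (RootPairing.Base.IsPos.or_neg b i).resolve_left hi
    · intro i hi
      simp only [Finset.mem_filter, Finset.mem_univ, true_and] at hi ⊢
      rw [RootPairing.Base.IsPos.neg_iff_not]
      exact not_not.mpr hi
    · intro i _
      exact neg_neg i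
    · intro i _
      exact neg_neg i
    · intro i _
      have : P.root (-i) = - P.root i := by
        simp [P.root_reflectionPerm, P.reflection_apply_self]
      rw [this]
      simp
  have h := Finset.sum_filter_add_sum_filter_not (Finset.univ : Finset ι)
    (fun i => b.IsPos i) (fun i => |P.toLinearMap (P.root i) y|)
  rw [key] at h
  have h' : (∑ i : ι with b.IsPos i, |P.toLinearMap (P.root i) y|) = len b y := rfl
  rw [h'] at h
  linarith

theorem len_coreflection (b : P.Base) (i : ι) (y : Y) :
    len b (P.coreflection i y) = len b y := by
  have h : ∑ j : ι, |P.toLinearMap (P.root j) (P.coreflection i y)|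
      = ∑ j : ι, |P.toLinearMap (P.root j) y| := by
    refine Fintype.sum_equiv (P.reflectionPerm i) _ _ fun j => ?_
    rw [← P.reflectionPerm_root i j]
    simp only [P.coreflection_apply, map_sub, map_smul, LinearMap.sub_apply,
      LinearMap.smul_apply, smul_eq_mul]
    congr 1
    have : P.root' i y = P.toLinearMap (P.root i) y := rfl
    rw [this]
    ring
  have h1 := two_mul_len b (P.coreflection i y)
  have h2 := two_mul_len b y
  linarith

theorem len_weyl (b : P.Base) (w : weyl P) (y : Y) :
    len b ((w : Y ≃ₗ[ℤ] Y) y) = len b y := by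
  obtain ⟨w, hw⟩ := w
  change len b (w y) = len b y
  unfold weyl at hw
  induction hw using Subgroup.closure_induction generalizing y with
  | mem x hx =>
    obtain ⟨i, rfl⟩ := hx
    exact len_coreflection b i y
  | one => rfl
  | mul x z _ _ hx hz => exact (hx (z y)).trans (hz y)
  | inv x _ hx =>
    have h := hx (x⁻¹ y)
    rw [← h]
    congr 1
    exact LinearEquiv.apply_symm_apply x y

end Length

/-- The monoid `Y⁺` of dominant coweights. -/
def dominant (b : P.Base) : AddSubmonoid Y where
  carrier := {y | ∀ i, b.IsPos i → 0 ≤ P.toLinearMap (P.root i) y}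
  zero_mem' := by
    intro i _
    simp
  add_mem' := by
    intro y z hy hz i hi
    rw [map_add]
    exact add_nonneg (hy i hi) (hz i hi)

section Cone

variable [Fintype ι]

/-- The conic monoid `C(Y) = {(y, k) ∈ Y ⊕ ℤ : k ≥ ℓ(y)}`. -/
def cone (b : P.Base) : AddSubmonoid (Y × ℤ) where
  carrier := {c | len b c.1 ≤ c.2}
  zero_mem' := by simp [len_zero]
  add_mem' := by
    intro c d hc hd
    exact (len_add_le b c.1 d.1).trans (add_le_add hc hd)

/-- The action of an element of `W₀` on `C(Y)`, given by `(y, k) ↦ (w y, k)`. -/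
def coneAct (b : P.Base) (w : weyl P) : cone b ≃+ cone b where
  toFun c := ⟨((w : Y ≃ₗ[ℤ] Y) c.1.1, c.1.2), (len_weyl b w c.1.1).trans_le c.2⟩
  invFun c := ⟨(((w⁻¹ : weyl P) : Y ≃ₗ[ℤ] Y) c.1.1, c.1.2),
    (len_weyl b w⁻¹ c.1.1).trans_le c.2⟩
  left_inv c := Subtype.ext (Prod.ext (LinearEquiv.symm_apply_apply (w : Y ≃ₗ[ℤ] Y) c.1.1) rfl)
  right_inv c := Subtype.ext (Prod.ext (LinearEquiv.apply_symm_apply (w : Y ≃ₗ[ℤ] Y) c.1.1) rfl)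
  map_add' c d := Subtype.ext (Prod.ext (map_add (w : Y ≃ₗ[ℤ] Y) c.1.1 d.1.1) rfl)

/-- The element `(0, 1)` of `C(Y)`. -/
def coneUnit (b : P.Base) : cone b :=
  ⟨(0, 1), (len_zero b).trans_le zero_le_one⟩

variable (R : Type*) [CommRing R]

/-- The `R[q]`-algebra structure on the semigroup algebra `R[C(Y)]`, with `q ↦ e^{(0,1)}`. -/
instance coneAlgebra (b : P.Base) :
    Algebra (Polynomial R) (AddMonoidAlgebra R (cone b)) :=
  (Polynomial.aeval (R := R) (AddMonoidAlgebra.single (coneUnit b) (1 : R))).toRingHom.toAlgebra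

/-- The algebra of invariants `R[C(Y)]^{W₀}`, as an `R[q]`-subalgebra of `R[C(Y)]`. -/
def coneInvariants (b : P.Base) :
    Subalgebra (Polynomial R) (AddMonoidAlgebra R (cone b)) where
  carrier := {f | ∀ w : weyl P, AddMonoidAlgebra.domCongr R R (coneAct b w) f = f}
  mul_mem' := by
    intro f g hf hg w
    rw [map_mul, hf w, hg w]
  add_mem' := by
    intro f g hf hg w
    rw [map_add, hf w, hg w]
  algebraMap_mem' := by
    intro p w
    change AddMonoidAlgebra.domCongr R R (coneAct b w)
      (Polynomial.aeval (AddMonoidAlgebra.single (coneUnit b) (1 : R)) p)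
        = Polynomial.aeval (AddMonoidAlgebra.single (coneUnit b) (1 : R)) p
    have hu : coneAct b w (coneUnit b) = coneUnit b :=
      Subtype.ext (Prod.ext (map_zero (w : Y ≃ₗ[ℤ] Y)) rfl)
    rw [← Polynomial.aeval_algHom_apply, AddMonoidAlgebra.domCongr_single, hu]

/-- The algebra of invariants `R[Y]^{W₀}`, as an `R`-subalgebra of the group algebra `R[Y]`. -/
def latticeInvariants (P : RootDatum ι X Y) : Subalgebra R (AddMonoidAlgebra R Y) where
  carrier := {f | ∀ w : weyl P,
    AddMonoidAlgebra.domCongr R R (w : Y ≃ₗ[ℤ] Y).toAddEquiv f = f}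
  mul_mem' := by
    intro f g hf hg w
    rw [map_mul, hf w, hg w]
  add_mem' := by
    intro f g hf hg w
    rw [map_add, hf w, hg w]
  algebraMap_mem' := by
    intro r w
    exact AlgEquiv.commutes _ r

/-- The specialization `q = 1` of the cone algebra: `R[C(Y)] → R[Y]`, `e^{(y,k)} ↦ e^y`. -/
def coneAtOne (b : P.Base) : AddMonoidAlgebra R (cone b) →ₐ[R] AddMonoidAlgebra R Y :=
  AddMonoidAlgebra.mapDomainAlgHom R R ((AddMonoidHom.fst Y ℤ).comp (cone b).subtype)

/-- The specialization `q = 1` of coefficients: `R[q][Y⁺] → R[Y⁺]`. -/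
def dominantAtOne (b : P.Base) :
    AddMonoidAlgebra (Polynomial R) (dominant b) →ₐ[R] AddMonoidAlgebra R (dominant b) :=
  AddMonoidAlgebra.mapAlgHom (dominant b) (Polynomial.aeval (1 : R))

/-- The length filtration: `Fⁿ R[Y]` is the `R`-span of the `e^y` with `ℓ(y) ≤ n`. -/
def lenFiltration (b : P.Base) (n : ℕ) : Submodule R (AddMonoidAlgebra R Y) :=
  Submodule.span R {f | ∃ y : Y, len b y ≤ n ∧ f = AddMonoidAlgebra.single y 1}

theorem lenFiltration_mono (b : P.Base) {m n : ℕ} (h : m ≤ n) :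
    lenFiltration R b m ≤ lenFiltration R b n := by
  refine Submodule.span_mono ?_
  rintro f ⟨y, hy, rfl⟩
  exact ⟨y, hy.trans (by exact_mod_cast h), rfl⟩

theorem lenFiltration_mul (b : P.Base) (m n : ℕ) :
    lenFiltration R b m * lenFiltration R b n ≤ lenFiltration R b (m + n) := by
  unfold lenFiltration
  rw [Submodule.span_mul_span]
  refine Submodule.span_mono ?_
  rintro f ⟨g, ⟨y, hy, rfl⟩, h, ⟨z, hz, rfl⟩, rfl⟩
  refine ⟨y + z, ?_, ?_⟩
  · push_cast
    exact (len_add_le b y z).trans (add_le_add hy hz)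
  · simp [AddMonoidAlgebra.single_mul_single]

/-- The Rees algebra `⨁ₙ tⁿ Fⁿ R[Y]` of the length filtration, as a subalgebra of `R[Y][t]`. -/
def rees (b : P.Base) : Subalgebra R (Polynomial (AddMonoidAlgebra R Y)) where
  carrier := {f | ∀ n, f.coeff n ∈ lenFiltration R b n}
  mul_mem' := by
    intro f g hf hg n
    rw [Polynomial.coeff_mul]
    refine Submodule.sum_mem _ fun ij hij => ?_
    have h := lenFiltration_mul R b ij.1 ij.2 (Submodule.mul_mem_mul (hf ij.1) (hg ij.2))
    rwa [Finset.HasAntidiagonal.mem_antidiagonal.mp hij] at h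
  add_mem' := by
    intro f g hf hg n
    rw [Polynomial.coeff_add]
    exact Submodule.add_mem _ (hf n) (hg n)
  algebraMap_mem' := by
    intro r n
    rw [Polynomial.algebraMap_apply, Polynomial.coeff_C]
    split_ifs with h
    · rw [Algebra.algebraMap_eq_smul_one]
      refine Submodule.smul_mem _ _ (Submodule.subset_span ⟨0, ?_, rfl⟩)
      rw [len_zero]
      exact Int.natCast_nonneg n
    · exact Submodule.zero_mem _

end Cone

end BasedRootDatum

end

noncomputable section

/-! Let `2ρ` be the sum of the positive roots. Then `⟨2ρ, y⟩ ≤ ℓ(y)`, with equality exactly at the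
dominant coweights, and `⟨2ρ, ·⟩` is maximal on each Weyl group orbit at its dominant element.

The fundamental coweights `ϖᵢ` are only rational, so that their orbit sums `mᵢ` need not lie in
`R[Y]`. However `fᵢ = e^{-ϖᵢ} mᵢ` does. It has constant term `1` and otherwise terms of negative
`2ρ`-weight, and it satisfies `sⱼ fᵢ = e^{δᵢⱼ αⱼ^∨} fᵢ`. Hence `M_y = e^y ∏ᵢ fᵢ ^ ⟨αᵢ, y⟩` is
invariant, multiplicative in the dominant coweight `y`, and unitriangular for `2ρ`, so that the
`M_y` form an `R`-basis of `R[Y]^{W₀}` indexed by the monoid of dominant coweights.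

All terms of the invariant `M_y` have length at most `ℓ(y)`, and `ℓ` is additive on dominant
coweights, so `t^{ℓ(y)} M_y` lies in the Rees algebra and is again multiplicative in `y`. By
triangularity an invariant of length at most `n` is a combination of the `M_y` with `ℓ(y) ≤ n`, so
the `t^{ℓ(y)} M_y` form an `R[t]`-basis of the invariants in the Rees algebra. Setting `t = 1`
returns `M_y`. -/

section Unitriangular

open Finsupp

variable {R I V α : Type*} [Ring R] [AddCommGroup V] [Module R V] [LinearOrder α]

/-- A family `E` is unitriangular, with respect to the coordinates `ξ` and the ranking `h` of the
indices, if `E a` has coordinate `1` at `a` and otherwise nonzero coordinates only at indices ranked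
strictly below `a`. -/
def IsUnitriangular (ξ : V →ₗ[R] I →₀ R) (h : I → α) (E : I → V) : Prop :=
  ∀ a c, h a ≤ h c → ξ (E a) c = single a 1 c

namespace IsUnitriangular

variable {ξ : V →ₗ[R] I →₀ R} {h : I → α} {E : I → V}

theorem coord_linearCombination (hE : IsUnitriangular ξ h E) {v : I →₀ R} {c : I}
    (hc : ∀ a ∈ v.support, h a ≤ h c) : ξ (linearCombination R E v) c = v c := by
  classical
  calc ξ (linearCombination R E v) c = ∑ a ∈ v.support, v a * ξ (E a) c := by
        simp [linearCombination_apply, Finsupp.sum, Finsupp.finsetSum_apply]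
    _ = ∑ a ∈ v.support, v a * single a 1 c :=
        Finset.sum_congr rfl fun a ha => by rw [hE a c (hc a ha)]
    _ = v c := by simp +contextual [single_apply, eq_comm]

theorem linearIndependent (hE : IsUnitriangular ξ h E) : LinearIndependent R E := by
  refine linearIndependent_iff.mpr fun v hv => ?_
  by_contra hne
  obtain ⟨c, hc, hmax⟩ := v.support.exists_max_image h (support_nonempty_iff.mpr hne)
  have hvc := hE.coord_linearCombination hmax
  rw [hv, map_zero] at hvc
  exact mem_support_iff.mp hc hvc.symm

theorem coord_sub_top_layer (hE : IsUnitriangular ξ h E) {f : V} {n : α}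
    (hn : ∀ a, ξ f a ≠ 0 → h a ≤ n) {a : I}
    (ha : ξ (f - linearCombination R E ((ξ f).filter fun a => h a = n)) a ≠ 0) : h a < n := by
  classical
  by_contra hna
  have hcoord : ξ (linearCombination R E ((ξ f).filter fun a => h a = n)) a
      = (ξ f).filter (fun a => h a = n) a := by
    refine hE.coord_linearCombination fun c hc => ?_
    rw [support_filter, Finset.mem_filter] at hc
    exact hc.2.trans_le (not_lt.mp hna)
  rw [map_sub, Finsupp.sub_apply, hcoord, filter_apply] at ha
  split_ifs at ha with han
  · exact ha (sub_self _)
  · exact hna ((hn a (by simpa using ha)).lt_of_ne han)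

variable [WellFoundedLT α] {N : Submodule R V}

theorem mem_span_of_coord_le (hE : IsUnitriangular ξ h E) (hEN : ∀ a, E a ∈ N)
    (hN : ∀ f ∈ N, ξ f = 0 → f = 0) (n : α) {f : V} (hf : f ∈ N)
    (hn : ∀ a, ξ f a ≠ 0 → h a ≤ n) : f ∈ Submodule.span R (E '' {a | h a ≤ n}) := by
  classical
  induction n using WellFoundedLT.induction generalizing f with
  | ind n ih =>
  set g := linearCombination R E ((ξ f).filter fun a => h a = n)
  have hg : g ∈ Submodule.span R (E '' {a | h a ≤ n}) := by
    refine (mem_span_image_iff_linearCombination R).mpr ⟨_, fun a ha => ?_, rfl⟩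
    rw [Finset.mem_coe, support_filter, Finset.mem_filter] at ha
    exact ha.2.le
  have hgN : g ∈ N := Submodule.span_le.mpr (Set.image_subset_iff.mpr fun a _ => hEN a) hg
  have hlt := fun a => hE.coord_sub_top_layer hn (a := a)
  suffices f - g ∈ Submodule.span R (E '' {a | h a ≤ n}) by simpa using add_mem this hg
  by_cases h0 : ξ (f - g) = 0
  · rw [hN _ (sub_mem hf hgN) h0]
    exact zero_mem _
  obtain ⟨c, hc, hmax⟩ := (ξ (f - g)).support.exists_max_image h (support_nonempty_iff.mpr h0)
  have hcn : h c < n := hlt c (mem_support_iff.mp hc)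
  refine Submodule.span_mono (Set.image_mono fun a (ha : h a ≤ h c) => ha.trans hcn.le) ?_
  exact ih (h c) hcn (sub_mem hf hgN) fun a ha => hmax a (mem_support_iff.mpr ha)

theorem span_range_eq (hE : IsUnitriangular ξ h E) (hEN : ∀ a, E a ∈ N)
    (hN : ∀ f ∈ N, ξ f = 0 → f = 0) : Submodule.span R (Set.range E) = N := by
  refine le_antisymm (Submodule.span_le.mpr (Set.range_subset_iff.mpr hEN)) fun f hf => ?_
  by_cases h0 : ξ f = 0
  · rw [hN f hf h0]
    exact zero_mem _
  obtain ⟨c, -, hmax⟩ := (ξ f).support.exists_max_image h (support_nonempty_iff.mpr h0)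
  exact Submodule.span_mono (Set.image_subset_range _ _)
    (hE.mem_span_of_coord_le hEN hN (h c) hf fun a ha => hmax a (mem_support_iff.mpr ha))

end IsUnitriangular

end Unitriangular

section Monic

open AddMonoidAlgebra

variable {R M Γ : Type*} [Ring R] [AddMonoid M] [AddCommMonoid Γ] [PartialOrder Γ]

theorem mul_mem_supported {s t u : Set M} (h : ∀ a ∈ s, ∀ b ∈ t, a + b ∈ u)
    {f g : AddMonoidAlgebra R M} (hf : f ∈ supported R R s) (hg : g ∈ supported R R t) :
    f * g ∈ supported R R u := by
  classical
  intro c hc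
  obtain ⟨a, ha, b, hb, rfl⟩ := Finset.mem_add.mp (support_coeff_mul_subset f g hc)
  exact h a (hf ha) b (hg hb)

/-- `f` is `e^y` plus a combination of `e^z` of smaller weight `h z < h y`. The weight need not be
injective, so that this is stronger than having leading coefficient `1`. -/
def IsMonicAt (h : M →+ Γ) (f : AddMonoidAlgebra R M) (y : M) : Prop :=
  f - single y 1 ∈ supported R R {z | h z < h y}

theorem isMonicAt_single (h : M →+ Γ) (y : M) : IsMonicAt h (single y (1 : R)) y := by
  simp [IsMonicAt]

namespace IsMonicAt

variable {h : M →+ Γ} {f g : AddMonoidAlgebra R M} {y z : M}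

theorem mem_supported (hf : IsMonicAt h f y) : f ∈ supported R R {z | h z ≤ h y} := by
  have hlow : f - single y 1 ∈ supported R R {z | h z ≤ h y} :=
    supported_mono (fun z (hz : h z < h y) => hz.le) hf
  have htop : single y (1 : R) ∈ supported R R {z | h z ≤ h y} :=
    Finsupp.single_mem_supported R 1 (le_refl (h y))
  simpa using add_mem hlow htop

theorem coeff_eq (hf : IsMonicAt h f y) (hz : h y ≤ h z) :
    f.coeff z = Finsupp.single y 1 z := by
  have := mem_supported'.mp hf z hz.not_gt
  simpa [sub_eq_zero] using this

variable [IsOrderedCancelAddMonoid Γ]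

theorem mul (hf : IsMonicAt h f y) (hg : IsMonicAt h g z) : IsMonicAt h (f * g) (y + z) := by
  have hsplit : f * g - single (y + z) 1
      = (f - single y 1) * g + single y 1 * (g - single z 1) := by
    simp [sub_mul, mul_sub, single_mul_single]
  rw [IsMonicAt, hsplit]
  refine add_mem (mul_mem_supported ?_ hf hg.mem_supported)
    (mul_mem_supported ?_ (Finsupp.single_mem_supported R 1 (Set.mem_singleton y)) hg)
  · intro a ha c hc
    rw [Set.mem_ofPred_eq, map_add, map_add]
    exact add_lt_add_of_lt_of_le ha hc
  · rintro a rfl c hc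
    rw [Set.mem_ofPred_eq, map_add, map_add]
    exact add_lt_add_of_le_of_lt le_rfl hc

end IsMonicAt

variable (R) [IsOrderedCancelAddMonoid Γ] in
/-- The elements of the form `1` plus terms of negative weight. -/
def monicAtZero (h : M →+ Γ) : Submonoid (AddMonoidAlgebra R M) where
  carrier := {f | IsMonicAt h f 0}
  one_mem' := isMonicAt_single h 0
  mul_mem' hf hg := by simpa using IsMonicAt.mul hf hg

end Monic

section MultiplicativeBasis

open AddMonoidAlgebra

variable {S G A : Type*} [CommSemiring S] [AddMonoid G] [Semiring A] [Algebra S A]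
  (F : Multiplicative G →* A)

theorem lift_eq_linearCombination (p : AddMonoidAlgebra S G) :
    lift S A G F p = Finsupp.linearCombination S (fun g => F (.ofAdd g)) p.coeff :=
  lift_apply F p

theorem lift_injective (hF : LinearIndependent S fun g => F (.ofAdd g)) :
    Function.Injective (lift S A G F) :=
  fun _ _ h => coeff_injective (hF (by simpa only [lift_eq_linearCombination] using h))

theorem range_lift_eq {T : Subalgebra S A}
    (hT : Submodule.span S (Set.range fun g => F (.ofAdd g)) = Subalgebra.toSubmodule T) :
    (lift S A G F).range = T := by
  ext f
  rw [← Subalgebra.mem_toSubmodule T, ← hT, ← Finsupp.range_linearCombination]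
  exact coeffEquiv.exists_congr_left.trans (by simp [lift_eq_linearCombination])

/-- If the values of a monoid homomorphism `F` from `G` to `A` form a basis of the subalgebra `T`,
then `T` is the monoid algebra of `G`. -/
def equivOfMultiplicativeBasis {T : Subalgebra S A}
    (hF : LinearIndependent S fun g => F (.ofAdd g))
    (hT : Submodule.span S (Set.range fun g => F (.ofAdd g)) = Subalgebra.toSubmodule T) :
    T ≃ₐ[S] AddMonoidAlgebra S G :=
  ((AlgEquiv.ofInjective (lift S A G F) (lift_injective F hF)).trans
    (Subalgebra.equivOfEq _ _ (range_lift_eq F hT))).symm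

end MultiplicativeBasis

namespace BasedRootDatum

variable {ι X Y : Type*} [AddCommGroup X] [AddCommGroup Y] {P : RootDatum ι X Y}

section Weyl

theorem coreflection_reflectionPerm (i j : ι) :
    P.coreflection (P.reflectionPerm i j)
      = P.coreflection i * P.coreflection j * P.coreflection i :=
  P.flip.reflection_reflectionPerm

theorem pairing_coreflection (i j : ι) (y : Y) :
    P.toLinearMap (P.root j) (P.coreflection i y)
      = P.toLinearMap (P.root (P.reflectionPerm i j)) y :=
  P.flip.coroot'_reflection y

theorem pairing_coreflection_self (i : ι) (y : Y) :
    P.toLinearMap (P.root i) (P.coreflection i y) = -P.toLinearMap (P.root i) y := by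
  simp [pairing_coreflection]

theorem coreflection_mul_self (i : ι) : P.coreflection i * P.coreflection i = 1 := by
  rw [← sq, P.coreflection_sq]

theorem coreflection_mem_weyl (i : ι) : P.coreflection i ∈ weyl P :=
  Subgroup.subset_closure ⟨i, rfl⟩

theorem weyl_eq_closure_support [Finite ι] [P.IsReduced] (b : P.Base) :
    weyl P = Subgroup.closure (P.coreflection '' b.support) := by
  refine le_antisymm ((Subgroup.closure_le _).mpr ?_)
    (Subgroup.closure_mono (Set.image_subset_range _ _))
  rintro _ ⟨i, rfl⟩
  refine b.induction_reflect i
    (p := fun i => P.coreflection i ∈ Subgroup.closure (P.coreflection '' b.support))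
    (fun i hi => ?_) (fun i hi => Subgroup.subset_closure ⟨i, hi, rfl⟩) fun i j hi hj => ?_
  · rw [coreflection_reflectionPerm]
    exact mul_mem (mul_mem hi hi) hi
  · have hj' := Subgroup.subset_closure (Set.mem_image_of_mem P.coreflection hj)
    rw [coreflection_reflectionPerm]
    exact mul_mem (mul_mem hj' hi) hj'

end Weyl

section Words

variable (b : P.Base)

/-- The Weyl group element given by a word in the simple reflections. -/
def word (L : List b.support) : Y ≃ₗ[ℤ] Y :=
  (L.map fun i => P.coreflection i).prod

/-- The permutation of the root indices given by a word in the simple reflections. -/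
def wordPerm (L : List b.support) : Equiv.Perm ι :=
  (L.map fun i => P.reflectionPerm i).prod

@[simp] theorem word_nil : word b [] = 1 := rfl

@[simp] theorem word_cons (i : b.support) (L : List b.support) :
    word b (i :: L) = P.coreflection i * word b L :=
  List.prod_cons

@[simp] theorem word_append (L L' : List b.support) :
    word b (L ++ L') = word b L * word b L' := by
  simp [word]

@[simp] theorem wordPerm_cons (i : b.support) (L : List b.support) :
    wordPerm b (i :: L) = P.reflectionPerm i * wordPerm b L :=
  List.prod_cons

theorem word_inv (L : List b.support) : (word b L)⁻¹ = word b L.reverse := by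
  simp [word, List.prod_inv_reverse, Function.comp_def]

theorem pairing_wordPerm_word (L : List b.support) (j : ι) (y : Y) :
    P.toLinearMap (P.root (wordPerm b L j)) (word b L y) = P.toLinearMap (P.root j) y := by
  induction L with
  | nil => rfl
  | cons i L ih =>
    rw [wordPerm_cons, word_cons, Equiv.Perm.mul_apply, LinearEquiv.mul_apply,
      pairing_coreflection, P.reflectionPerm_self, ih]

theorem coreflection_wordPerm (L : List b.support) (j : ι) :
    P.coreflection (wordPerm b L j) * word b L = word b L * P.coreflection j := by
  induction L with
  | nil => simp [wordPerm]
  | cons i L ih =>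
    calc P.coreflection (wordPerm b (i :: L) j) * word b (i :: L)
        = P.coreflection i * P.coreflection (wordPerm b L j)
            * (P.coreflection i * P.coreflection i) * word b L := by
          simp [coreflection_reflectionPerm, mul_assoc]
      _ = word b (i :: L) * P.coreflection j := by
          rw [coreflection_mul_self, mul_one, mul_assoc, ih, word_cons, mul_assoc]

variable [Finite ι] [P.IsReduced]

theorem exists_word_eq_of_mem_weyl {w : Y ≃ₗ[ℤ] Y} (hw : w ∈ weyl P) :
    ∃ L : List b.support, w = word b L := by
  rw [weyl_eq_closure_support b] at hw
  induction hw using Subgroup.closure_induction with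
  | mem x hx =>
    obtain ⟨i, hi, rfl⟩ := hx
    exact ⟨[⟨i, hi⟩], by simp⟩
  | one => exact ⟨[], rfl⟩
  | mul x y _ _ ihx ihy =>
    obtain ⟨L, rfl⟩ := ihx
    obtain ⟨L', rfl⟩ := ihy
    exact ⟨L ++ L', (word_append b L L').symm⟩
  | inv x _ ihx =>
    obtain ⟨L, rfl⟩ := ihx
    exact ⟨L.reverse, word_inv b L⟩

variable {b}

theorem not_isPos_reflectionPerm_iff {i j : ι} (hi : i ∈ b.support) (hj : b.IsPos j) :
    ¬ b.IsPos (P.reflectionPerm i j) ↔ j = i := by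
  refine ⟨fun h => by_contra fun hne => h (hj.reflectionPerm hi hne), ?_⟩
  rintro rfl
  exact fun h => (RootPairing.Base.IsPos.neg_iff_not b j).mp h hj

theorem exchange (L : List b.support) (j : b.support) (h : ¬ b.IsPos (wordPerm b L j)) :
    ∃ L' : List b.support, L'.length + 1 = L.length ∧
      word b L * P.coreflection j = word b L' := by
  induction L with
  | nil => exact absurd (b.isPos_of_mem_support j.2) h
  | cons i L ih =>
    by_cases hpos : b.IsPos (wordPerm b L j)
    · have hi : wordPerm b L j = i := (not_isPos_reflectionPerm_iff i.2 hpos).mp (by simpa using h)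
      refine ⟨L, rfl, ?_⟩
      rw [word_cons, mul_assoc, ← coreflection_wordPerm, hi, ← mul_assoc, coreflection_mul_self,
        one_mul]
    · obtain ⟨L', hlength, hword⟩ := ih hpos
      exact ⟨i :: L', by simpa using hlength, by rw [word_cons, word_cons, mul_assoc, hword]⟩

theorem word_apply_eq_of_dominant {y : Y} (hy : y ∈ dominant b) (L : List b.support)
    (hL : word b L y ∈ dominant b) : word b L y = y := by
  induction hn : L.length using Nat.strong_induction_on generalizing L with
  | _ n ih =>
  rcases List.eq_nil_or_concat' L with rfl | ⟨T, j, rfl⟩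
  · rfl
  have hlength : T.length + 1 = n := by simpa using hn
  simp only [word_append, word_cons, word_nil, mul_one] at hL ⊢
  by_cases hpos : b.IsPos (wordPerm b T j)
  · -- `⟨α_j, s_j y⟩` and its negative `⟨α_j, y⟩` are both nonnegative.
    have hfixed : P.coreflection j y = y := by
      have h₁ : 0 ≤ P.toLinearMap (P.root j) (P.coreflection j y) := by
        simpa only [LinearEquiv.mul_apply, pairing_wordPerm_word] using hL _ hpos
      have h₂ := hy _ (b.isPos_of_mem_support j.2)
      rw [pairing_coreflection_self] at h₁
      have h₀ : P.root' j y = 0 := le_antisymm (by exact neg_nonneg.mp h₁) h₂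
      rw [P.coreflection_apply, h₀, zero_smul, sub_zero]
    rw [LinearEquiv.mul_apply, hfixed] at hL ⊢
    exact ih _ (by lia) T hL rfl
  · obtain ⟨L', hlength', hword⟩ := exchange T j hpos
    rw [hword] at hL ⊢
    exact ih _ (by lia) L' hL rfl

theorem weyl_apply_eq_of_dominant {y : Y} (hy : y ∈ dominant b) {w : weyl P}
    (h : (w : Y ≃ₗ[ℤ] Y) y ∈ dominant b) : (w : Y ≃ₗ[ℤ] Y) y = y := by
  obtain ⟨L, hL⟩ := exists_word_eq_of_mem_weyl b w.2
  rw [hL] at h ⊢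
  exact word_apply_eq_of_dominant hy L h

end Words

theorem mem_dominant_of_support [Finite ι] {b : P.Base} {y : Y}
    (h : ∀ i ∈ b.support, 0 ≤ P.toLinearMap (P.root i) y) : y ∈ dominant b := by
  intro i hi
  refine hi.induction_on_add h fun i j k hk hi hj => ?_
  rw [hk, map_add, LinearMap.add_apply]
  exact add_nonneg hi (h j hj)

section Height

variable [Fintype ι]

open Classical in
/-- The pairing with `2ρ`, the sum of the positive roots. It agrees with the length on the dominant
coweights and, unlike the length, is additive. -/
def twoRho (b : P.Base) : Y →+ ℤ :=
  ∑ i : ι with b.IsPos i, (P.toLinearMap (P.root i)).toAddMonoidHom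

variable (b : P.Base)

open Classical in
theorem twoRho_apply (y : Y) :
    twoRho b y = ∑ i : ι with b.IsPos i, P.toLinearMap (P.root i) y := by
  simp [twoRho, AddMonoidHom.finsetSum_apply]

theorem twoRho_le_len (y : Y) : twoRho b y ≤ len b y := by
  rw [twoRho_apply]
  exact Finset.sum_le_sum fun i _ => le_abs_self _

variable {b} in
theorem twoRho_eq_len_iff {y : Y} : twoRho b y = len b y ↔ y ∈ dominant b := by
  rw [twoRho_apply, len, Finset.sum_eq_sum_iff_of_le fun i _ => le_abs_self _]
  simp [dominant, eq_comm (b := |_|)]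

/-- The length as a natural number. -/
def natLen (y : Y) : ℕ := (len b y).toNat

@[simp] theorem cast_natLen (y : Y) : (natLen b y : ℤ) = len b y :=
  Int.toNat_of_nonneg (len_nonneg b y)

theorem natLen_zero : natLen b (0 : Y) = 0 := by
  simp [natLen, len_zero]

variable {b}

theorem natLen_add_of_dominant {y z : Y} (hy : y ∈ dominant b) (hz : z ∈ dominant b) :
    natLen b (y + z) = natLen b y + natLen b z := by
  zify
  simp only [cast_natLen, ← twoRho_eq_len_iff.mpr hy, ← twoRho_eq_len_iff.mpr hz,
    ← twoRho_eq_len_iff.mpr (add_mem hy hz), map_add]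

variable [P.IsReduced]

open Classical in
theorem reflectionPerm_mem_isPos_erase {j : ι} (hj : j ∈ b.support) {i : ι}
    (hi : i ∈ (Finset.univ.filter fun i => b.IsPos i).erase j) :
    P.reflectionPerm j i ∈ (Finset.univ.filter fun i => b.IsPos i).erase j := by
  simp only [Finset.mem_erase, Finset.mem_filter, Finset.mem_univ, true_and] at hi ⊢
  have hpos := hi.2.reflectionPerm hj hi.1
  refine ⟨fun h => ?_, hpos⟩
  have hneg := (not_isPos_reflectionPerm_iff hj hpos).mpr h
  rw [P.reflectionPerm_self] at hneg
  exact hneg hi.2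

theorem twoRho_coreflection {j : ι} (hj : j ∈ b.support) (y : Y) :
    twoRho b (P.coreflection j y) = twoRho b y - 2 * P.toLinearMap (P.root j) y := by
  classical
  set s := Finset.univ.filter fun i => b.IsPos i
  have hmem : j ∈ s := by simpa [s] using b.isPos_of_mem_support hj
  have hrest : ∑ i ∈ s.erase j, P.toLinearMap (P.root i) (P.coreflection j y)
      = ∑ i ∈ s.erase j, P.toLinearMap (P.root i) y :=
    Finset.sum_nbij' (P.reflectionPerm j) (P.reflectionPerm j)
      (fun i hi => reflectionPerm_mem_isPos_erase hj hi)
      (fun i hi => reflectionPerm_mem_isPos_erase hj hi)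
      (fun i _ => P.reflectionPerm_self j i) (fun i _ => P.reflectionPerm_self j i)
      (fun i _ => pairing_coreflection j i y)
  rw [twoRho_apply, twoRho_apply, ← Finset.add_sum_erase s _ hmem, ← Finset.add_sum_erase s _ hmem,
    hrest, pairing_coreflection_self]
  ring

theorem twoRho_weyl_lt {y : Y} (hy : y ∈ dominant b) {w : weyl P}
    (hne : (w : Y ≃ₗ[ℤ] Y) y ≠ y) : twoRho b ((w : Y ≃ₗ[ℤ] Y) y) < twoRho b y := by
  rw [twoRho_eq_len_iff.mpr hy, ← len_weyl b w y]
  refine (twoRho_le_len b _).lt_of_ne fun h => hne ?_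
  exact weyl_apply_eq_of_dominant hy (twoRho_eq_len_iff.mp h)

end Height

theorem exists_weyl_apply_mem_dominant [Finite ι] [P.IsReduced] (b : P.Base) (y : Y) :
    ∃ w : weyl P, (w : Y ≃ₗ[ℤ] Y) y ∈ dominant b := by
  have := Fintype.ofFinite ι
  induction hn : (len b y - twoRho b y).toNat using Nat.strong_induction_on generalizing y with
  | _ n ih =>
  by_cases hy : ∀ i ∈ b.support, 0 ≤ P.toLinearMap (P.root i) y
  · exact ⟨1, mem_dominant_of_support hy⟩
  push Not at hy
  obtain ⟨j, hj, hlt⟩ := hy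
  have hdecr : (len b (P.coreflection j y) - twoRho b (P.coreflection j y)).toNat < n := by
    have h₁ := twoRho_coreflection hj y
    have h₂ := twoRho_le_len b (P.coreflection j y)
    rw [len_coreflection] at h₂ ⊢
    lia
  obtain ⟨w, hw⟩ := ih _ hdecr (P.coreflection j y) rfl
  exact ⟨w * (⟨_, coreflection_mem_weyl j⟩ : weyl P), hw⟩

section FiniteOrbits

theorem weyl_sub_mem_corootSpan (w : weyl P) (y : Y) :
    (w : Y ≃ₗ[ℤ] Y) y - y ∈ P.corootSpan ℤ := by
  obtain ⟨w, hw⟩ := w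
  change w y - y ∈ _
  induction hw using Subgroup.closure_induction generalizing y with
  | mem x hx =>
    obtain ⟨i, rfl⟩ := hx
    rw [P.coreflection_apply, sub_sub_cancel_left]
    exact neg_mem (Submodule.smul_mem _ _ (Submodule.subset_span ⟨i, rfl⟩))
  | one => simp
  | mul x z _ _ hx hz => simpa using add_mem (hx (z y)) (hz y)
  | inv x _ hx =>
    have := neg_mem (hx (x⁻¹ y))
    simpa [show x (x⁻¹ y) = y from LinearEquiv.apply_symm_apply x y] using this

theorem eq_zero_of_mem_corootSpan [Finite ι] {y : Y} (hy : y ∈ P.corootSpan ℤ)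
    (h : ∀ i, P.toLinearMap (P.root i) y = 0) : y = 0 := by
  have := Fintype.ofFinite ι
  refine Submodule.disjoint_def.mp P.disjoint_corootSpan_ker_corootForm y hy ?_
  have hroot' : ∀ i, P.root' i y = 0 := h
  ext z
  simp [RootPairing.CorootForm, RootPairing.rootForm_apply_apply, hroot']

theorem abs_pairing_le [Fintype ι] (b : P.Base) (i : ι) (y : Y) :
    |P.toLinearMap (P.root i) y| ≤ 2 * len b y := by
  rw [two_mul_len]
  exact Finset.single_le_sum (f := fun i => |P.toLinearMap (P.root i) y|)
    (fun i _ => abs_nonneg _) (Finset.mem_univ i)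

theorem finite_orbit [Finite ι] (b : P.Base) (y : Y) : (MulAction.orbit (weyl P) y).Finite := by
  have := Fintype.ofFinite ι
  refine Set.Finite.of_finite_image (f := fun z i => P.toLinearMap (P.root i) z) ?_ ?_
  · refine (Set.Finite.pi' fun _ : ι => Set.finite_Icc (-(2 * len b y)) (2 * len b y)).subset ?_
    rintro _ ⟨_, ⟨w, rfl⟩, rfl⟩ i
    have hle := abs_pairing_le b i ((w : Y ≃ₗ[ℤ] Y) y)
    rw [len_weyl] at hle
    exact Set.mem_Icc.mpr (abs_le.mp hle)
  · rintro _ ⟨w, rfl⟩ _ ⟨w', rfl⟩ h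
    have hmem := sub_mem (weyl_sub_mem_corootSpan w y) (weyl_sub_mem_corootSpan w' y)
    rw [sub_sub_sub_cancel_right] at hmem
    refine sub_eq_zero.mp (eq_zero_of_mem_corootSpan hmem fun i => ?_)
    rw [map_sub]
    exact sub_eq_zero.mpr (congrFun h i)

end FiniteOrbits

section FundamentalCoweights

variable (b : P.Base)

variable {b} in
theorem pairing_eq_zero_of_support [Finite ι] {y : Y}
    (h : ∀ i ∈ b.support, P.toLinearMap (P.root i) y = 0) (i : ι) :
    P.toLinearMap (P.root i) y = 0 := by
  refine b.induction_add i (fun i hi => ?_) h fun i j k hk hi hj => ?_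
  · simpa using hi
  · rw [hk, map_add, LinearMap.add_apply, hi, h j hj, add_zero]

theorem cartanMatrix_apply (i j : b.support) :
    b.cartanMatrix i j = P.toLinearMap (P.root i) (P.coroot j) :=
  b.algebraMap_cartanMatrixIn_apply ℤ i j

variable [Finite ι]

open Classical in
theorem cartanMatrix_det_ne_zero : b.cartanMatrix.det ≠ 0 := by
  intro h
  obtain ⟨v, hv, hv₀⟩ := Matrix.exists_mulVec_eq_zero_iff.mpr h
  have hsum : ∑ j, v j • P.coroot j = 0 := by
    refine eq_zero_of_mem_corootSpan (P := P)
      (Submodule.sum_mem _ fun j _ => Submodule.smul_mem _ _ (Submodule.subset_span ⟨j, rfl⟩))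
      (pairing_eq_zero_of_support (b := b) fun i hi => ?_)
    simpa [Matrix.mulVec, dotProduct, cartanMatrix_apply, mul_comm] using congrFun hv₀ ⟨i, hi⟩
  exact hv (funext (Fintype.linearIndependent_iff.mp b.linearIndepOn_coroot v hsum))

open Classical in
theorem exists_scaled_fundamental_coweights :
    ∃ d : ℤ, 0 < d ∧ ∃ η : b.support → Y, ∀ i j : b.support,
      P.toLinearMap (P.root j) (η i) = d * if i = j then 1 else 0 := by
  set C := b.cartanMatrix
  refine ⟨C.det * C.det, mul_self_pos.mpr (cartanMatrix_det_ne_zero b),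
    fun i => C.det • ∑ k, C.adjugate k i • P.coroot k, fun i j => ?_⟩
  calc P.toLinearMap (P.root j) (C.det • ∑ k, C.adjugate k i • P.coroot k)
      = C.det * (C * C.adjugate) j i := by
        simp [C, Matrix.mul_apply, cartanMatrix_apply, mul_comm]
    _ = C.det * C.det * if i = j then 1 else 0 := by
        simp [Matrix.mul_adjugate, Matrix.one_apply, eq_comm]

end FundamentalCoweights

end BasedRootDatum

namespace BasedRootDatum

open AddMonoidAlgebra

variable {ι X Y : Type*} [AddCommGroup X] [AddCommGroup Y] {P : RootDatum ι X Y}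

section DividedOrbit

theorem zsmul_injective (P : RootDatum ι X Y) {d : ℤ} (hd : d ≠ 0) :
    Function.Injective fun y : Y => d • y := by
  have : Module.IsReflexive ℤ Y := .of_isPerfPair P.flip.toLinearMap
  exact smul_right_injective Y hd

/-- The Weyl group orbit of the rational coweight `η / d`, shifted by `-η / d`. -/
def dividedOrbit (P : RootDatum ι X Y) (d : ℤ) (η : Y) : Set Y :=
  {q | η + d • q ∈ MulAction.orbit (weyl P) η}

theorem zero_mem_dividedOrbit (d : ℤ) (η : Y) : 0 ∈ dividedOrbit P d η := by
  simp [dividedOrbit]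

theorem coreflection_sub_mem_dividedOrbit {d c : ℤ} {η q : Y} {j : ι}
    (hc : P.toLinearMap (P.root j) η = d * c) (hq : q ∈ dividedOrbit P d η) :
    P.coreflection j q - c • P.coroot j ∈ dividedOrbit P d η := by
  have hη : P.coreflection j η = η - (d * c) • P.coroot j := by
    rw [← hc]
    rfl
  have hshift : η + d • (P.coreflection j q - c • P.coroot j) = P.coreflection j (η + d • q) := by
    rw [map_add, map_smul, hη, mul_smul]
    module
  rw [dividedOrbit, Set.mem_ofPred_eq, hshift]
  exact MulAction.mem_orbit_of_mem_orbit (⟨_, coreflection_mem_weyl j⟩ : weyl P) hq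

variable {d : ℤ}

theorem finite_dividedOrbit [Finite ι] (b : P.Base) (hd : d ≠ 0) (η : Y) :
    (dividedOrbit P d η).Finite :=
  (finite_orbit b η).preimage ((add_right_injective η).comp (zsmul_injective P hd)).injOn

variable (R : Type*) [CommRing R] (b : P.Base)

/-- The element `e^{-η/d} m(η/d)` of the group algebra, where `m(η/d)` is the sum of the
exponentials over the Weyl group orbit of `η/d`. -/
def dividedOrbitSum [Finite ι] (hd : d ≠ 0) (η : Y) : AddMonoidAlgebra R Y :=
  ∑ q ∈ (finite_dividedOrbit b hd η).toFinset, single q 1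

theorem domCongr_coreflection_dividedOrbitSum [Finite ι] (hd : d ≠ 0) {η : Y} {j : ι} {c : ℤ}
    (hc : P.toLinearMap (P.root j) η = d * c) :
    domCongr R R (P.coreflection j).toAddEquiv (dividedOrbitSum R b hd η)
      = single (c • P.coroot j) 1 * dividedOrbitSum R b hd η := by
  have hmem : ∀ q ∈ (finite_dividedOrbit b hd η).toFinset,
      P.coreflection j q - c • P.coroot j ∈ (finite_dividedOrbit b hd η).toFinset := by
    simpa only [Set.Finite.mem_toFinset] using fun q => coreflection_sub_mem_dividedOrbit hc
  have hinv : ∀ q : Y,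
      P.coreflection j (P.coreflection j q - c • P.coroot j) - c • P.coroot j = q := by
    simp
  rw [dividedOrbitSum, map_sum, Finset.mul_sum]
  refine Finset.sum_nbij' (fun q => P.coreflection j q - c • P.coroot j)
    (fun q => P.coreflection j q - c • P.coroot j) hmem hmem (fun q _ => hinv q)
    (fun q _ => hinv q) fun q _ => ?_
  simp [single_mul_single]

variable [Fintype ι]

theorem dividedOrbitSum_mem_monicAtZero [P.IsReduced] (hd : 0 < d) {η : Y} (hη : η ∈ dominant b) :
    dividedOrbitSum R b hd.ne' η ∈ monicAtZero R (twoRho b) := by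
  classical
  have hzero : 0 ∈ (finite_dividedOrbit b hd.ne' η).toFinset :=
    (Set.Finite.mem_toFinset _).mpr (zero_mem_dividedOrbit d η)
  change dividedOrbitSum R b hd.ne' η - single 0 1 ∈ supported R R {q | twoRho b q < twoRho b 0}
  rw [dividedOrbitSum, ← Finset.add_sum_erase _ _ hzero, add_sub_cancel_left]
  refine Submodule.sum_mem _ fun q hq => Finsupp.single_mem_supported R 1 ?_
  obtain ⟨hq₀, hq⟩ := Finset.mem_erase.mp hq
  obtain ⟨w, hw⟩ := (Set.Finite.mem_toFinset _).mp hq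
  change (w : Y ≃ₗ[ℤ] Y) η = η + d • q at hw
  have hne : (w : Y ≃ₗ[ℤ] Y) η ≠ η := by
    simpa [hw] using (zsmul_injective P hd.ne').ne hq₀
  have hlt := twoRho_weyl_lt hη hne
  rw [hw, map_add, map_zsmul, smul_eq_mul, add_lt_iff_neg_left] at hlt
  rw [Set.mem_ofPred_eq, map_zero]
  exact neg_of_mul_neg_right hlt hd.le

open Classical in
theorem exists_fundamental_family [P.IsReduced] :
    ∃ f : b.support → AddMonoidAlgebra R Y, (∀ i, f i ∈ monicAtZero R (twoRho b)) ∧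
      ∀ i j : b.support, domCongr R R (P.coreflection j).toAddEquiv (f i)
        = single ((if i = j then 1 else 0 : ℤ) • P.coroot j) 1 * f i := by
  obtain ⟨d, hd, η, hη⟩ := exists_scaled_fundamental_coweights b
  refine ⟨fun i => dividedOrbitSum R b hd.ne' (η i),
    fun i => dividedOrbitSum_mem_monicAtZero R b hd (mem_dominant_of_support fun j hj => ?_),
    fun i j => domCongr_coreflection_dividedOrbitSum R b hd.ne' (hη i j)⟩
  rw [hη i ⟨j, hj⟩]
  positivity

end DividedOrbit

section DominantFamily

variable {R : Type*} [CommRing R] (b : P.Base)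

theorem mem_latticeInvariants_iff [Finite ι] [P.IsReduced] {f : AddMonoidAlgebra R Y} :
    f ∈ latticeInvariants R P ↔
      ∀ j : b.support, domCongr R R (P.coreflection j).toAddEquiv f = f := by
  refine ⟨fun hf j => hf ⟨_, coreflection_mem_weyl (j : ι)⟩, fun hf w => ?_⟩
  obtain ⟨L, hL⟩ := exists_word_eq_of_mem_weyl b w.2
  rw [hL]
  clear hL
  induction L with
  | nil => exact DFunLike.congr_fun domCongr_refl f
  | cons i L ih =>
    have hmul : domCongr R R (word b (i :: L)).toAddEquiv f
        = domCongr R R (P.coreflection i).toAddEquiv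
          (domCongr R R (word b L).toAddEquiv f) := by
      ext y
      simp
      rfl
    rw [hmul, ih, hf i]

/-- The pairing of a dominant coweight with a simple root, as a natural number. -/
def simplePairing (i : b.support) : dominant b →+ ℕ where
  toFun y := (P.toLinearMap (P.root i) (y : Y)).toNat
  map_zero' := by simp
  map_add' y z := by
    have h (y : dominant b) := y.2 _ (b.isPos_of_mem_support i.2)
    rw [AddSubmonoid.coe_add, map_add, Int.toNat_add (h y) (h z)]

theorem cast_simplePairing (i : b.support) (y : dominant b) :
    (simplePairing b i y : ℤ) = P.toLinearMap (P.root i) (y : Y) :=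
  Int.toNat_of_nonneg (y.2 _ (b.isPos_of_mem_support i.2))

/-- The monoid homomorphism sending a dominant coweight `y` to `e^y ∏ᵢ fᵢ ^ ⟨αᵢ, y⟩`, the product
running over the simple roots. -/
def dominantFamily (f : b.support → AddMonoidAlgebra R Y) :
    Multiplicative (dominant b) →* AddMonoidAlgebra R Y :=
  (of R Y).comp (AddMonoidHom.toMultiplicative (dominant b).subtype) *
    ∏ i, (powersHom _ (f i)).comp (AddMonoidHom.toMultiplicative (simplePairing b i))

theorem dominantFamily_apply (f : b.support → AddMonoidAlgebra R Y) (y : dominant b) :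
    dominantFamily b f (.ofAdd y) = single (y : Y) 1 * ∏ i, f i ^ simplePairing b i y := by
  simp [dominantFamily]

open Classical in
theorem dominantFamily_mem_latticeInvariants [Finite ι] [P.IsReduced]
    {f : b.support → AddMonoidAlgebra R Y}
    (hf : ∀ i j : b.support, domCongr R R (P.coreflection j).toAddEquiv (f i)
      = single ((if i = j then 1 else 0 : ℤ) • P.coroot j) 1 * f i) (y : dominant b) :
    dominantFamily b f (.ofAdd y) ∈ latticeInvariants R P := by
  refine (mem_latticeInvariants_iff b).mpr fun j => ?_
  have hprod : ∏ i, (single ((if i = j then 1 else 0 : ℤ) • P.coroot j) 1 : AddMonoidAlgebra R Y)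
      ^ simplePairing b i y = single (P.toLinearMap (P.root j) (y : Y) • P.coroot j) 1 := by
    rw [Finset.prod_eq_single j (fun i _ hij => by simp [hij, ← one_def]) (by simp),
      ← cast_simplePairing]
    simp [single_pow]
  have hsum : P.coreflection j (y : Y) + P.toLinearMap (P.root j) (y : Y) • P.coroot j = y :=
    sub_add_cancel _ _
  rw [dominantFamily_apply, map_mul, map_prod]
  simp only [map_pow, hf, mul_pow, Finset.prod_mul_distrib]
  rw [hprod, ← mul_assoc, domCongr_single, single_mul_single, one_mul]
  exact congrArg (fun z => single z 1 * _) hsum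

theorem isMonicAt_dominantFamily [Fintype ι] {f : b.support → AddMonoidAlgebra R Y}
    (hf : ∀ i, f i ∈ monicAtZero R (twoRho b)) (y : dominant b) :
    IsMonicAt (twoRho b) (dominantFamily b f (.ofAdd y)) (y : Y) := by
  have hprod : ∏ i, f i ^ simplePairing b i y ∈ monicAtZero R (twoRho b) :=
    prod_mem fun i _ => pow_mem (hf i) _
  rw [dominantFamily_apply]
  simpa using (isMonicAt_single (twoRho b) (y : Y)).mul hprod

end DominantFamily

end BasedRootDatum

namespace BasedRootDatum

open AddMonoidAlgebra

variable {ι X Y : Type*} [AddCommGroup X] [AddCommGroup Y] {P : RootDatum ι X Y}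

section Filtration

variable (R : Type*) [CommRing R]

theorem coeff_weyl {f : AddMonoidAlgebra R Y} (hf : f ∈ latticeInvariants R P) (w : weyl P)
    (y : Y) : f.coeff ((w : Y ≃ₗ[ℤ] Y) y) = f.coeff y := by
  conv_lhs => rw [← hf w]
  simp

variable [Fintype ι]

theorem mem_lenFiltration_iff (b : P.Base) {f : AddMonoidAlgebra R Y} {n : ℕ} :
    f ∈ lenFiltration R b n ↔ ∀ y, f.coeff y ≠ 0 → len b y ≤ n := by
  have hset : {f | ∃ y : Y, len b y ≤ n ∧ f = single y (1 : R)}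
      = (fun y => single y 1) '' {y | len b y ≤ n} := by
    ext f
    simp [eq_comm]
  rw [lenFiltration, hset, ← supported_eq_span_single, mem_supported]
  simp [Set.subset_def]

theorem mem_lenFiltration_of_isMonicAt [P.IsReduced] (b : P.Base) {f : AddMonoidAlgebra R Y} {y : Y}
    (hf : IsMonicAt (twoRho b) f y) (hinv : f ∈ latticeInvariants R P) :
    f ∈ lenFiltration R b (natLen b y) := by
  refine (mem_lenFiltration_iff R b).mpr fun z hz => ?_
  obtain ⟨w, hw⟩ := exists_weyl_apply_mem_dominant b z
  have hwz : f.coeff ((w : Y ≃ₗ[ℤ] Y) z) ≠ 0 := by rwa [coeff_weyl R hinv w]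
  calc len b z = twoRho b ((w : Y ≃ₗ[ℤ] Y) z) := by rw [twoRho_eq_len_iff.mpr hw, len_weyl]
    _ ≤ twoRho b y := mem_supported.mp hf.mem_supported (Finsupp.mem_support_iff.mpr hwz)
    _ ≤ natLen b y := by simpa using twoRho_le_len b y

end Filtration

section DominantBasis

variable (R : Type*) [CommRing R] (b : P.Base)

/-- The coefficients of an element of the group algebra at the dominant coweights. -/
def dominantCoeff : AddMonoidAlgebra R Y →ₗ[R] dominant b →₀ R :=
  (Finsupp.lcomapDomain Subtype.val Subtype.val_injective).comp (coeffLinearEquiv R).toLinearMap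

theorem dominantCoeff_apply (f : AddMonoidAlgebra R Y) (y : dominant b) :
    dominantCoeff R b f y = f.coeff (y : Y) := rfl

variable {R b}

theorem eq_zero_of_dominantCoeff_eq_zero [Finite ι] [P.IsReduced] {f : AddMonoidAlgebra R Y}
    (hf : f ∈ latticeInvariants R P) (h : dominantCoeff R b f = 0) : f = 0 := by
  ext z
  obtain ⟨w, hw⟩ := exists_weyl_apply_mem_dominant b z
  rw [← coeff_weyl R hf w]
  exact DFunLike.congr_fun h ⟨_, hw⟩

variable [Fintype ι]

theorem isUnitriangular_of_isMonicAt {E : dominant b → AddMonoidAlgebra R Y}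
    (hE : ∀ y, IsMonicAt (twoRho b) (E y) (y : Y)) :
    IsUnitriangular (dominantCoeff R b) (fun y : dominant b => natLen b (y : Y)) E := by
  intro y z hyz
  have hle : twoRho b (y : Y) ≤ twoRho b (z : Y) := by
    rw [twoRho_eq_len_iff.mpr y.2, twoRho_eq_len_iff.mpr z.2, ← cast_natLen, ← cast_natLen]
    exact_mod_cast hyz
  rw [dominantCoeff_apply, (hE y).coeff_eq hle]
  exact Finsupp.single_apply_left Subtype.val_injective y z 1

/-- A multiplicative system of Weyl group invariants indexed by the dominant coweights `y`, each
being `e^y` plus terms on which the pairing with `2ρ` is smaller. -/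
structure IsDominantBasis (M : Multiplicative (dominant b) →* AddMonoidAlgebra R Y) : Prop where
  isMonicAt (y : dominant b) : IsMonicAt (twoRho b) (M (.ofAdd y)) (y : Y)
  mem_latticeInvariants (y : dominant b) : M (.ofAdd y) ∈ latticeInvariants R P

variable (R b) in
theorem exists_isDominantBasis [P.IsReduced] :
    ∃ M : Multiplicative (dominant b) →* AddMonoidAlgebra R Y, IsDominantBasis M := by
  obtain ⟨f, hmonic, hf⟩ := exists_fundamental_family R b
  exact ⟨dominantFamily b f, isMonicAt_dominantFamily b hmonic,
    dominantFamily_mem_latticeInvariants b hf⟩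

namespace IsDominantBasis

variable {M : Multiplicative (dominant b) →* AddMonoidAlgebra R Y}

theorem linearIndependent (hM : IsDominantBasis M) :
    LinearIndependent R fun y => M (.ofAdd y) :=
  (isUnitriangular_of_isMonicAt hM.isMonicAt).linearIndependent

variable [P.IsReduced]

theorem span_range_eq (hM : IsDominantBasis M) :
    Submodule.span R (Set.range fun y => M (.ofAdd y))
      = Subalgebra.toSubmodule (latticeInvariants R P) :=
  (isUnitriangular_of_isMonicAt hM.isMonicAt).span_range_eq hM.mem_latticeInvariants
    fun _ hf => eq_zero_of_dominantCoeff_eq_zero hf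

theorem mem_span_of_mem_lenFiltration (hM : IsDominantBasis M) {f : AddMonoidAlgebra R Y} {n : ℕ}
    (hf : f ∈ latticeInvariants R P) (hn : f ∈ lenFiltration R b n) :
    f ∈ Submodule.span R ((fun y => M (.ofAdd y)) '' {y | natLen b (y : Y) ≤ n}) := by
  refine (isUnitriangular_of_isMonicAt hM.isMonicAt).mem_span_of_coord_le
    (N := Subalgebra.toSubmodule (latticeInvariants R P)) hM.mem_latticeInvariants
    (fun _ hf => eq_zero_of_dominantCoeff_eq_zero hf) n hf fun y hy => ?_
  have := (mem_lenFiltration_iff R b).mp hn y hy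
  rw [← cast_natLen] at this
  exact_mod_cast this

end IsDominantBasis

end DominantBasis

end BasedRootDatum

namespace BasedRootDatum

open AddMonoidAlgebra Polynomial

variable {ι X Y : Type*} [AddCommGroup X] [AddCommGroup Y] {P : RootDatum ι X Y}
  [Fintype ι] (R : Type*) [CommRing R]

section Rees

variable (b : P.Base)

variable {b} in
theorem nonneg_of_mem_cone (c : cone b) : 0 ≤ c.1.2 :=
  (len_nonneg b c.1.1).trans c.2

/-- The map `e^{(y,k)} ↦ t^k e^y` from the cone algebra to `R[Y][t]`. -/
def coneToPoly : AddMonoidAlgebra R (cone b) →ₐ[R] Polynomial (AddMonoidAlgebra R Y) :=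
  lift R (Polynomial (AddMonoidAlgebra R Y)) (cone b)
    { toFun c := monomial c.toAdd.1.2.toNat (single c.toAdd.1.1 1)
      map_one' := by simp [← one_def]
      map_mul' c d := by
        rw [monomial_mul_monomial, single_mul_single, one_mul, toAdd_mul,
          ← Int.toNat_add (nonneg_of_mem_cone c.toAdd) (nonneg_of_mem_cone d.toAdd)]
        rfl }

@[simp] theorem coneToPoly_single (c : cone b) (r : R) :
    coneToPoly R b (single c r) = monomial c.1.2.toNat (single c.1.1 r) := by
  simp [coneToPoly, smul_monomial]

theorem coeff_coeff_coneToPoly (f : AddMonoidAlgebra R (cone b)) (c : cone b) :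
    ((coneToPoly R b f).coeff c.1.2.toNat).coeff c.1.1 = f.coeff c := by
  classical
  induction f using AddMonoidAlgebra.induction_linear with
  | zero => simp
  | add f g hf hg => simp [hf, hg]
  | single d r =>
    have hiff : d = c ↔ d.1.2.toNat = c.1.2.toNat ∧ d.1.1 = c.1.1 := by
      have hd := nonneg_of_mem_cone d
      have hc := nonneg_of_mem_cone c
      rw [Subtype.ext_iff, Prod.ext_iff]
      lia
    rw [coneToPoly_single, coeff_monomial, coeff_single, Finsupp.single_apply,
      if_congr hiff rfl rfl, ite_and]
    split_ifs <;> simp [*]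

theorem coneToPoly_injective : Function.Injective (coneToPoly R b) := by
  intro f g h
  ext c
  rw [← coeff_coeff_coneToPoly, ← coeff_coeff_coneToPoly, h]

theorem monomial_mem_rees {n : ℕ} {f : AddMonoidAlgebra R Y} (hf : f ∈ lenFiltration R b n) :
    monomial n f ∈ rees R b := by
  intro k
  rw [coeff_monomial]
  split_ifs with h
  · exact h ▸ hf
  · exact zero_mem _

theorem coneToPoly_mem_rees (f : AddMonoidAlgebra R (cone b)) : coneToPoly R b f ∈ rees R b := by
  classical
  induction f using AddMonoidAlgebra.induction_linear with
  | zero => exact (map_zero (coneToPoly R b)).symm ▸ zero_mem _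
  | add f g hf hg => exact (map_add (coneToPoly R b) f g).symm ▸ add_mem hf hg
  | single c r =>
    rw [coneToPoly_single]
    refine monomial_mem_rees R b ((mem_lenFiltration_iff R b).mpr fun y hy => ?_)
    obtain rfl : c.1.1 = y := by
      by_contra hne
      simp [hne] at hy
    rw [Int.toNat_of_nonneg (nonneg_of_mem_cone c)]
    exact c.2

theorem exists_coneToPoly_eq {p : Polynomial (AddMonoidAlgebra R Y)} (hp : p ∈ rees R b) :
    ∃ f, coneToPoly R b f = p := by
  have hmonomial (n : ℕ) : lenFiltration R b n ≤
      (LinearMap.range (coneToPoly R b).toLinearMap).comap ((monomial n).restrictScalars R) := by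
    rw [lenFiltration, Submodule.span_le]
    rintro _ ⟨y, hy, rfl⟩
    exact ⟨single ⟨(y, n), hy⟩ 1, by simp⟩
  change p ∈ LinearMap.range (coneToPoly R b).toLinearMap
  rw [p.as_sum_support]
  exact Submodule.sum_mem _ fun n _ => hmonomial n (hp n)

/-- The cone algebra is the Rees algebra of the length filtration. -/
def coneEquivRees : AddMonoidAlgebra R (cone b) ≃ₐ[R] rees R b :=
  AlgEquiv.ofBijective ((coneToPoly R b).codRestrict (rees R b) (coneToPoly_mem_rees R b))
    ⟨fun _ _ h => coneToPoly_injective R b (congrArg Subtype.val h), fun p =>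
      (exists_coneToPoly_eq R b p.2).imp fun _ hf => Subtype.ext hf⟩

theorem coe_coneEquivRees (f : AddMonoidAlgebra R (cone b)) :
    (coneEquivRees R b f : Polynomial (AddMonoidAlgebra R Y)) = coneToPoly R b f := rfl

theorem eval_one_coneToPoly (f : AddMonoidAlgebra R (cone b)) :
    (coneToPoly R b f).eval 1 = coneAtOne R b f := by
  induction f using AddMonoidAlgebra.induction_linear with
  | zero => simp
  | add f g hf hg => simp [hf, hg]
  | single c r => simp [coneAtOne]

theorem coneToPoly_smul (p : Polynomial R) (f : AddMonoidAlgebra R (cone b)) :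
    coneToPoly R b (p • f) = p.map (algebraMap R (AddMonoidAlgebra R Y)) * coneToPoly R b f := by
  have hunit : coneToPoly R b (single (coneUnit b) 1) = Polynomial.X := by
    simp [coneUnit, ← one_def, monomial_one_one_eq_X]
  have hp : coneToPoly R b (algebraMap (Polynomial R) (AddMonoidAlgebra R (cone b)) p)
      = p.map (algebraMap R (AddMonoidAlgebra R Y)) := by
    change coneToPoly R b (aeval (single (coneUnit b) 1) p) = _
    rw [← aeval_algHom_apply, hunit, aeval_X_left_eq_map]
  rw [Algebra.smul_def, map_mul, hp]

theorem coeff_coneToPoly_domCongr (w : weyl P) (f : AddMonoidAlgebra R (cone b)) (n : ℕ) :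
    (coneToPoly R b (domCongr R R (coneAct b w) f)).coeff n
      = domCongr R R (w : Y ≃ₗ[ℤ] Y).toAddEquiv ((coneToPoly R b f).coeff n) := by
  induction f using AddMonoidAlgebra.induction_linear with
  | zero => simp
  | add f g hf hg => simp only [map_add, Polynomial.coeff_add, hf, hg]
  | single c r =>
    rw [domCongr_single, coneToPoly_single, coneToPoly_single, coeff_monomial, coeff_monomial]
    split_ifs with h h'
    · simp [coneAct]
    · exact absurd h h'
    · exact absurd ‹_› h
    · simp

theorem mem_coneInvariants_iff {f : AddMonoidAlgebra R (cone b)} :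
    f ∈ coneInvariants R b ↔ ∀ n, (coneToPoly R b f).coeff n ∈ latticeInvariants R P := by
  refine ⟨fun hf n w => ?_, fun hf w => coneToPoly_injective R b (Polynomial.ext fun n => ?_)⟩
  · rw [← coeff_coneToPoly_domCongr, hf w]
  · rw [coeff_coneToPoly_domCongr, hf n w]

end Rees

section ConeBasis

variable {R} {b : P.Base} {M : Multiplicative (dominant b) →* AddMonoidAlgebra R Y}
  {F : Multiplicative (dominant b) →* AddMonoidAlgebra R (cone b)}

/-- In terms of the Rees algebra, `F` is the family of the `t^{ℓ(y)} M_y`. -/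
def IsReesLift (M : Multiplicative (dominant b) →* AddMonoidAlgebra R Y)
    (F : Multiplicative (dominant b) →* AddMonoidAlgebra R (cone b)) : Prop :=
  ∀ y, coneToPoly R b (F (.ofAdd y)) = monomial (natLen b (y : Y)) (M (.ofAdd y))

theorem IsDominantBasis.exists_isReesLift [P.IsReduced] (hM : IsDominantBasis M) :
    ∃ F, IsReesLift M F := by
  have hrees (y : dominant b) : monomial (natLen b (y : Y)) (M (.ofAdd y)) ∈ rees R b :=
    monomial_mem_rees R b
      (mem_lenFiltration_of_isMonicAt R b (hM.isMonicAt y) (hM.mem_latticeInvariants y))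
  choose F hF using fun y : dominant b => exists_coneToPoly_eq R b (hrees y)
  refine ⟨⟨⟨fun y => F y.toAdd, coneToPoly_injective R b ?_⟩,
    fun y z => coneToPoly_injective R b ?_⟩, hF⟩
  · rw [toAdd_one, hF, map_one]
    simp [natLen_zero]
  · rw [map_mul, hF, hF, hF, monomial_mul_monomial, ← natLen_add_of_dominant y.toAdd.2 z.toAdd.2]
    simp

namespace IsReesLift

theorem coeff_coneToPoly_smul (hF : IsReesLift M F) (p : Polynomial R) (y : dominant b) (n : ℕ) :
    (coneToPoly R b (p • F (.ofAdd y))).coeff n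
      = (if natLen b (y : Y) ≤ n then p.coeff (n - natLen b (y : Y)) else 0) • M (.ofAdd y) := by
  rw [coneToPoly_smul, hF, ← C_mul_X_pow_eq_monomial, ← mul_assoc, coeff_mul_X_pow', coeff_mul_C,
    Polynomial.coeff_map, ite_smul, zero_smul, Algebra.smul_def]

theorem linearIndependent (hF : IsReesLift M F)
    (hM : LinearIndependent R fun y => M (.ofAdd y)) :
    LinearIndependent (Polynomial R) fun y => F (.ofAdd y) := by
  refine linearIndependent_iff'.mpr fun s p hp y hy => Polynomial.ext fun n => ?_
  have hcoeff : ∑ z ∈ s, (if natLen b (z : Y) ≤ n + natLen b (y : Y) then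
      (p z).coeff (n + natLen b (y : Y) - natLen b (z : Y)) else 0) • M (.ofAdd z) = 0 := by
    simpa only [map_sum, finsetSum_coeff, hF.coeff_coneToPoly_smul, map_zero,
      Polynomial.coeff_zero] using
      congrArg (fun f => (coneToPoly R b f).coeff (n + natLen b (y : Y))) hp
  simpa using linearIndependent_iff'.mp hM s _ hcoeff y hy

theorem exists_mem_span_coneToPoly_eq_monomial (hF : IsReesLift M F)
    {f : AddMonoidAlgebra R Y} {n : ℕ}
    (hf : f ∈ Submodule.span R ((fun y => M (.ofAdd y)) '' {y | natLen b (y : Y) ≤ n})) :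
    ∃ g ∈ Submodule.span (Polynomial R) (Set.range fun y => F (.ofAdd y)),
      coneToPoly R b g = monomial n f := by
  induction hf using Submodule.span_induction with
  | zero => exact ⟨0, zero_mem _, by simp⟩
  | add f f' _ _ hf hf' =>
    obtain ⟨g, hg, hgf⟩ := hf
    obtain ⟨g', hg', hgf'⟩ := hf'
    exact ⟨g + g', add_mem hg hg', by rw [map_add, map_add, hgf, hgf']⟩
  | smul r f _ hf =>
    obtain ⟨g, hg, hgf⟩ := hf
    refine ⟨C r • g, Submodule.smul_mem _ _ hg, ?_⟩
    rw [coneToPoly_smul, hgf, Polynomial.map_C, C_mul_monomial, Algebra.smul_def]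
  | mem f hf =>
    obtain ⟨y, hy, rfl⟩ := hf
    refine ⟨Polynomial.X ^ (n - natLen b (y : Y)) • F (.ofAdd y),
      Submodule.smul_mem _ _ (Submodule.subset_span ⟨y, rfl⟩), ?_⟩
    rw [coneToPoly_smul, hF, Polynomial.map_pow, map_X, X_pow_mul_monomial,
      Nat.add_sub_cancel' hy]

theorem span_range_eq [P.IsReduced] (hF : IsReesLift M F) (hM : IsDominantBasis M) :
    Submodule.span (Polynomial R) (Set.range fun y => F (.ofAdd y))
      = Subalgebra.toSubmodule (coneInvariants R b) := by
  refine le_antisymm (Submodule.span_le.mpr ?_) fun f hf => ?_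
  · rintro _ ⟨y, rfl⟩
    refine (mem_coneInvariants_iff R b).mpr fun n => ?_
    rw [hF, coeff_monomial]
    split_ifs
    · exact hM.mem_latticeInvariants y
    · exact zero_mem _
  · choose g hg hgf using fun n => hF.exists_mem_span_coneToPoly_eq_monomial
      (hM.mem_span_of_mem_lenFiltration ((mem_coneInvariants_iff R b).mp hf n)
        (coneToPoly_mem_rees R b f n))
    have hsum : ∑ n ∈ (coneToPoly R b f).support, g n = f := coneToPoly_injective R b <| by
      simp only [map_sum, hgf]
      exact (as_sum_support _).symm
    exact hsum ▸ Submodule.sum_mem _ fun n _ => hg n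

theorem coneAtOne_lift (hF : IsReesLift M F) (p : AddMonoidAlgebra (Polynomial R) (dominant b)) :
    coneAtOne R b (lift (Polynomial R) _ (dominant b) F p)
      = lift R _ (dominant b) M (dominantAtOne R b p) := by
  induction p using AddMonoidAlgebra.induction_linear with
  | zero => simp
  | add p p' hp hp' => simp only [map_add, hp, hp']
  | single y p =>
    rw [lift_single, ← eval_one_coneToPoly, coneToPoly_smul, hF, eval_mul, eval_one_map]
    simp [dominantAtOne, Algebra.smul_def, coe_aeval_eq_eval]

end IsReesLift

end ConeBasis

end BasedRootDatum

end

open BasedRootDatum in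
theorem theorem3p1_general (R : Type*) [CommRing R] {ι X Y : Type*} [Fintype ι]
    [AddCommGroup X] [AddCommGroup Y] (P : RootDatum ι X Y) [P.IsReduced] (b : P.Base) :
    (∃ ρ : AddMonoidAlgebra R (cone b) ≃ₐ[R] rees R b,
      ∀ (y : Y) (k : ℕ) (h : (y, (k : ℤ)) ∈ cone b),
        (ρ (AddMonoidAlgebra.single ⟨(y, (k : ℤ)), h⟩ 1) : Polynomial (AddMonoidAlgebra R Y)) =
          Polynomial.monomial k (AddMonoidAlgebra.single y 1)) ∧
    ∃ φ : coneInvariants R b ≃ₐ[Polynomial R] AddMonoidAlgebra (Polynomial R) (dominant b),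
      ∃ ψ : latticeInvariants R P ≃ₐ[R] AddMonoidAlgebra R (dominant b),
        ∀ f : coneInvariants R b,
          (ψ.symm (dominantAtOne R b (φ f)) : AddMonoidAlgebra R Y) =
            coneAtOne R b (f : AddMonoidAlgebra R (cone b)) := by
  refine ⟨⟨coneEquivRees R b, fun y k h => by simp [coe_coneEquivRees]⟩, ?_⟩
  obtain ⟨M, hM⟩ := exists_isDominantBasis R b
  obtain ⟨F, hF⟩ := hM.exists_isReesLift
  let φ := equivOfMultiplicativeBasis F (hF.linearIndependent hM.linearIndependent)
    (hF.span_range_eq hM)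
  let ψ := equivOfMultiplicativeBasis M hM.linearIndependent hM.span_range_eq
  refine ⟨φ, ψ, fun f => ?_⟩
  calc (ψ.symm (dominantAtOne R b (φ f)) : AddMonoidAlgebra R Y)
      = coneAtOne R b (φ.symm (φ f) : AddMonoidAlgebra R (cone b)) := (hF.coneAtOne_lift _).symm
    _ = coneAtOne R b (f : AddMonoidAlgebra R (cone b)) := by rw [φ.symm_apply_apply]

theorem theorem3p1 (R : Type*) [CommRing R] {ι X Y : Type*} [Fintype ι]
    [AddCommGroup X] [AddCommGroup Y] [Module.Finite ℤ X] [Module.Finite ℤ Y]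
    (P : RootDatum ι X Y) [P.IsReduced] (b : P.Base) :
    -- the cone algebra is the Rees algebra of the length filtration
    (∃ ρ : AddMonoidAlgebra R (BasedRootDatum.cone b) ≃ₐ[R] BasedRootDatum.rees R b,
      ∀ (y : Y) (k : ℕ) (h : (y, (k : ℤ)) ∈ BasedRootDatum.cone b),
        (ρ (AddMonoidAlgebra.single ⟨(y, (k : ℤ)), h⟩ 1) : Polynomial (AddMonoidAlgebra R Y)) =
          Polynomial.monomial k (AddMonoidAlgebra.single y 1)) ∧
    -- the main isomorphism, together with its specialization at `q = 1`
    ∃ φ : BasedRootDatum.coneInvariants R b ≃ₐ[Polynomial R]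
        AddMonoidAlgebra (Polynomial R) (BasedRootDatum.dominant b),
      ∃ ψ : BasedRootDatum.latticeInvariants R P ≃ₐ[R]
          AddMonoidAlgebra R (BasedRootDatum.dominant b),
        ∀ f : BasedRootDatum.coneInvariants R b,
          (ψ.symm (BasedRootDatum.dominantAtOne R b (φ f)) : AddMonoidAlgebra R Y) =
            BasedRootDatum.coneAtOne R b (f : AddMonoidAlgebra R (BasedRootDatum.cone b)) :=
  theorem3p1_general R P b
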